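/- **Setting.** Let $S^1=[-1,1]/(-1\sim 1)$ with Lebesgue measure $m_{S^1}$, and $T^2=S^1\times S^1$ with $m_{T^2}=m_{S^1}\times m_{S^1}$. For a map $f:M\to M$ and $x\in M$ put $\sigma_n(x)=\frac1n\sum_{j=0}^{n-1}\delta_{f^j(x)}$. The basin $B(\mu)$ of a Borel probability measure $\mu$ is the set of $x$ with $\int\varphi\,d\sigma_n(x)\to\int\varphi\,d\mu$ for every continuous $\varphi:M\to\mathbb R$. An $f$-invariant Borel probability measure $\mu$ is *physical* if $B(\mu)$ has positive Lebesgue measure. **Bowen's construction** in $[c-r,c+r]$. Take $0<b<r$ and $\alpha_n>0$ $(n\ge1)$ with $\sum_{n\ge 1}\alpha_n<2(r-b)$, $\alpha_{n+1}<\alpha_n$, $\alpha_{n+1}/\alpha_n\to1$, $\alpha_1<2b$. The gap of generation $0$ is $(c-b,c+b)$; the atoms of generation $1$ are $I_0=[c-r,c-b]$ and $I_1=[c+b,c+r]$. Inductively, the atom $I_{a_0\dots a_{n-1}}$ $(n\ge1$, $a_j\in\{0,1\})$ contains, at its centre, the open gap $I^*_{a_0\dots a_{n-1}}$ of generation $n$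 and of length $\alpha_n/2^n$, whose removal leaves the atom $I_{a_0\dots a_{n-1}0}$ on the left and the atom $I_{a_0\dots a_{n-1}1}$ on the right. Let $K$ be the Cantor set $\bigcap_{n\ge1}\bigcup_{a_0\dots a_{n-1}}I_{a_0\dots a_{n-1}}$. A *Bowen map* for these data is a continuous map $G:I_0\cup I_1\to[c-r,c+r]$ such that for all $n\ge 0$ it maps each gap $I^*_{a_0a_1\dots a_n}$ onto the gap $I^*_{a_1\dots a_n}$ (the gap of generation $0$ if $n=0$) by a $C^1$ increasing map with derivative bounded below by a constant greater than $1$; $G'\to2$ at both end points of each gap; and, for some $\epsilon_n\to0$, $|G'-2|<\epsilon_n$ on all gaps of generation $n+1$, $n\ge1$. **The map $f_1$.** Let $G$ be a Bowen map in $[-1,1]$ with gap of generation $0$ equal to $(-b,b)$ and Cantor set $K_{S^1}$. Let $G_c:[-b,b]\to[-1,1]$ be a $C^1$, increasing, surjective map with derivative bounded below by a constant greater than $1$ and equal to $2$ at $\pm b$. Let $f_1:S^1\to S^1$ be induced by $G$ on $I_0\cup I_1$ and by $G_c$ on $(-b,b)$. **The map $f_2$.** Let $k\ge1$. For $1\le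 i\le k$ let $G_i$ be a Bowen map with Cantor set $K_{i,S^1}$, where the construction is carried out in $[-1,1]$ for $i=1$ and, for $i\ge2$, in a compact interval contained in a gap (the host gap of $i$) of some $K_{j,S^1}$ with $j<i$; different $i$ have different host gaps. Let $f_2:S^1\to S^1$ be a $C^1$ orientation preserving uniformly expanding map that coincides with $G_i$ on the domain of $G_i$, for every $i$, except possibly inside those gaps of $K_{i,S^1}$ that are host gaps of later indices. Let $f(x,y)=(f_1(x),f_2(y))$ on $T^2$. Put $\mu_{K_{S^1}}(B)=\frac{m_{S^1}(B\cap K_{S^1})}{m_{S^1}(K_{S^1})}$, $\mu_{K_{i,S^1}}(B)=\frac{m_{S^1}(B\cap K_{i,S^1})}{m_{S^1}(K_{i,S^1})}$ for Borel sets $B\subset S^1$, and $\mu_{K_{i,T^2}}=\mu_{K_{S^1}}\times\mu_{K_{i,S^1}}$. **Proposition.** For every $i\in\{1,\dots,k\}$ the measure $\mu_{K_{i,T^2}}$ is physical for $f$: it is an $f$-invariant Borel probability measure on $T^2$, and $m_{T^2}(B(\mu_{K_{i,T^2}}))>0$. -/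

import Mathlib

open Set Filter Topology MeasureTheory

noncomputable section

/-! ### Empiric probabilities, basins of statistical attraction, physical measures -/

section Physical

variable {M : Type*} [TopologicalSpace M] [MeasurableSpace M]

/-- The empiric probability `(1/n) ∑_{j<n} δ_{f^j(x)}` (for `n ≥ 1`). -/
def empiricMeasure (f : M → M) (n : ℕ) (x : M) : Measure M :=
  (n : ENNReal)⁻¹ • ∑ j ∈ Finset.range n, Measure.dirac (f^[j] x)

/-- The basin of statistical attraction of `μ`: the points `x` whose empiric probabilities
converge to `μ` in the weak-star topology. -/
def statBasin (f : M → M) (μ : Measure M) : Set M :=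
  {x | ∀ φ : C(M, ℝ),
    Tendsto (fun n : ℕ => ∫ y, φ y ∂(empiricMeasure f n x)) atTop (𝓝 (∫ y, φ y ∂μ))}

/-- `μ` is a physical measure of `f` with respect to the reference (Lebesgue) measure `m`:
an `f`-invariant probability measure whose basin has positive `m`-measure. -/
structure IsPhysical (m : Measure M) (f : M → M) (μ : Measure M) : Prop where
  isProbabilityMeasure : IsProbabilityMeasure μ
  invariant : MeasurePreserving f μ μ
  basin_pos : 0 < m (statBasin f μ)

end Physical

/-! ### Bowen's Cantor sets of positive measure -/

/-- Parameters of Bowen's construction in the interval `[mid - rad, mid + rad]`: the gap of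
generation `0` is `(mid - b, mid + b)`, and each of the `2^n` gaps of generation `n ≥ 1` has
length `α n / 2^n`.  The value `α 0` is irrelevant. -/
structure BowenParam where
  mid : ℝ
  rad : ℝ
  b : ℝ
  α : ℕ → ℝ
  b_pos : 0 < b
  b_lt_rad : b < rad
  α_pos : ∀ n, 1 ≤ n → 0 < α n
  α_summable : Summable fun n => α (n + 1)
  α_tsum_lt : ∑' n, α (n + 1) < 2 * (rad - b)
  α_strictAnti : ∀ n, 1 ≤ n → α (n + 1) < α n
  α_ratio : Tendsto (fun n => α (n + 1) / α n) atTop (𝓝 1)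
  α_one_lt : α 1 < 2 * b

/-- The shift `a₀ a₁ a₂ … ↦ a₁ a₂ …`. -/
def shiftSeq (a : ℕ → Bool) : ℕ → Bool := fun n => a (n + 1)

namespace BowenParam

variable (P : BowenParam)

/-- Half of the length of the gaps of generation `n`. -/
def gapRad : ℕ → ℝ
  | 0 => P.b
  | n + 1 => P.α (n + 1) / 2 ^ (n + 1) / 2

/-- Half of the length of the atoms of generation `n` (generation `0` is the whole interval). -/
def atomRad : ℕ → ℝ
  | 0 => P.rad
  | n + 1 => (atomRad n - P.gapRad n) / 2

/-- The common centre of the atom and of the gap of generation `n` with word `a₀ … a_{n-1}`.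
Words of length `n` are given as infinite sequences of which only the first `n` terms are used;
`false` is the symbol `0` (left) and `true` is the symbol `1` (right). -/
def centre : ℕ → (ℕ → Bool) → ℝ
  | 0, _ => P.mid
  | n + 1, a =>
    if a n then centre n a + (P.gapRad n + P.atomRad (n + 1))
    else centre n a - (P.gapRad n + P.atomRad (n + 1))

/-- The atom `I_{a₀ … a_{n-1}}` of generation `n`. -/
def atom (n : ℕ) (a : ℕ → Bool) : Set ℝ :=
  Icc (P.centre n a - P.atomRad n) (P.centre n a + P.atomRad n)

/-- The gap `I*_{a₀ … a_{n-1}}` of generation `n`. -/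
def gap (n : ℕ) (a : ℕ → Bool) : Set ℝ :=
  Ioo (P.centre n a - P.gapRad n) (P.centre n a + P.gapRad n)

/-- The whole interval in which the construction takes place. -/
def interval : Set ℝ := Icc (P.mid - P.rad) (P.mid + P.rad)

/-- The union `I_0 ∪ I_1` of the two atoms of generation `1`. -/
def dom : Set ℝ :=
  Icc (P.mid - P.rad) (P.mid - P.b) ∪ Icc (P.mid + P.b) (P.mid + P.rad)

/-- The Cantor set: the intersection over `n` of the union of the atoms of generation `n`. -/
def cantor : Set ℝ := ⋂ n : ℕ, ⋃ a : ℕ → Bool, P.atom n a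

end BowenParam

/-! ### Bowen's expanding maps -/

/-- Order preserving and uniformly expanding on the open set `s`. -/
def IsExpandingOn (G : ℝ → ℝ) (s : Set ℝ) : Prop :=
  ∃ c : ℝ, 1 < c ∧ ∀ x ∈ s, c ≤ deriv G x

/-- `G` (of which only the values on `I_0 ∪ I_1` matter) is a map given by Bowen's construction:
it is continuous on `I_0 ∪ I_1`, and maps each gap `I*_{a₀ a₁ … a_n}` onto the gap
`I*_{a₁ … a_n}` by a `C¹` order preserving expanding map, with the derivative tending to `2` at
the end points of each gap, and uniformly close to `2` on the gaps of high generation. -/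
structure IsBowenMap (P : BowenParam) (G : ℝ → ℝ) : Prop where
  continuousOn : ContinuousOn G P.dom
  contDiffOn_gap : ∀ n a, ContDiffOn ℝ 1 G (P.gap (n + 1) a)
  expanding_gap : ∀ n a, IsExpandingOn G (P.gap (n + 1) a)
  image_gap : ∀ n a, G '' P.gap (n + 1) a = P.gap n (shiftSeq a)
  deriv_left : ∀ n a,
    Tendsto (deriv G) (𝓝[>] (P.centre (n + 1) a - P.gapRad (n + 1))) (𝓝 2)
  deriv_right : ∀ n a,
    Tendsto (deriv G) (𝓝[<] (P.centre (n + 1) a + P.gapRad (n + 1))) (𝓝 2)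
  deriv_near_two : ∃ ε : ℕ → ℝ, Tendsto ε atTop (𝓝 0) ∧
    ∀ n, 1 ≤ n → ∀ a, ∀ x ∈ P.gap (n + 1) a, |deriv G x - 2| < ε n

/-! ### The circle and the two families of examples on it -/

instance fact_zero_lt_two_real : Fact ((0 : ℝ) < 2) := ⟨two_pos⟩

/-- The circle `S¹ = [-1, 1] / (-1 ∼ 1) = ℝ / 2ℤ`; its `volume` is the Lebesgue measure, of total
mass `2`. -/
abbrev S1 : Type := AddCircle (2 : ℝ)

/-- The torus `T² = S¹ × S¹`; its `volume` is the product of the Lebesgue measures. -/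
abbrev T2 : Type := S1 × S1

/-- `f` is an order preserving `C¹` uniformly expanding map of the circle (in terms of a lift). -/
def IsC1ExpandingCircleMap (f : S1 → S1) : Prop :=
  ∃ F : ℝ → ℝ, ContDiff ℝ 1 F ∧ (∃ c : ℝ, 1 < c ∧ ∀ x, c ≤ deriv F x) ∧
    ∀ x : ℝ, f (x : S1) = (F x : S1)

/-- The normalized restriction `B ↦ m (B ∩ K) / m K` of Lebesgue measure to `K ⊆ S¹`. -/
def normLeb (K : Set S1) : Measure S1 := ProbabilityTheory.cond volume K

/-- The choices made in the first example on the circle: Bowen's construction in `[-1, 1]`, and a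
`C¹` expanding order preserving map `Gc` of `[-b, b]` onto `[-1, 1]` that has derivative `2` at the
end points. -/
structure FirstExample where
  P : BowenParam
  mid_eq : P.mid = 0
  rad_eq : P.rad = 1
  G : ℝ → ℝ
  isBowenMap : IsBowenMap P G
  Gc : ℝ → ℝ
  contDiffOn_Gc : ContDiffOn ℝ 1 Gc (Icc (-P.b) P.b)
  expanding_Gc : IsExpandingOn Gc (Ioo (-P.b) P.b)
  image_Gc : Gc '' Icc (-P.b) P.b = Icc (-1) 1
  deriv_Gc_left : Tendsto (deriv Gc) (𝓝[>] (-P.b)) (𝓝 2)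
  deriv_Gc_right : Tendsto (deriv Gc) (𝓝[<] P.b) (𝓝 2)

namespace FirstExample

variable (E : FirstExample)

open Classical in
/-- The map of `[-1, 1]` that is `G` on `I_0 ∪ I_1` and `Gc` on the gap `(-b, b)`. -/
def intervalMap (x : ℝ) : ℝ := if x ∈ Ioo (-E.P.b) E.P.b then E.Gc x else E.G x

/-- The induced map of the circle. -/
def map : S1 → S1 := AddCircle.liftIco 2 (-1) fun x => (E.intervalMap x : S1)

/-- The Cantor set of the first example, in the circle. -/
def cantor : Set S1 := (fun x : ℝ => (x : S1)) '' E.P.cantor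

end FirstExample

/-- The second example on the circle, with `k` Cantor sets.  The Cantor set of index `0` is given
by Bowen's construction in `[-1, 1]`.  The Cantor set of index `i ≠ 0` is given by Bowen's
construction in a compact interval inside a gap (the host gap of `i`) of one of the Cantor sets of
smaller index; different indices use different host gaps.  The map is a `C¹` expanding map of the
circle that coincides with the `i`-th Bowen map on its domain, except inside those gaps of the
`i`-th Cantor set that are host gaps of later Cantor sets, where it has been modified. -/
structure SecondExample (k : ℕ) where
  P : Fin k → BowenParam
  G : Fin k → ℝ → ℝ
  isBowenMap : ∀ i, IsBowenMap (P i) (G i)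
  mid_eq : ∀ i : Fin k, (i : ℕ) = 0 → (P i).mid = 0
  rad_eq : ∀ i : Fin k, (i : ℕ) = 0 → (P i).rad = 1
  hostIndex : Fin k → Fin k
  hostGap : Fin k → Set ℝ
  hostIndex_lt : ∀ i : Fin k, (i : ℕ) ≠ 0 → hostIndex i < i
  hostGap_isGap : ∀ i : Fin k, (i : ℕ) ≠ 0 → ∃ n a, hostGap i = (P (hostIndex i)).gap n a
  interval_subset : ∀ i : Fin k, (i : ℕ) ≠ 0 → (P i).interval ⊆ hostGap i
  hostGap_ne : ∀ i j : Fin k, (i : ℕ) ≠ 0 → (j : ℕ) ≠ 0 → i ≠ j → hostGap i ≠ hostGap j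
  map : S1 → S1
  expanding : IsC1ExpandingCircleMap map
  map_eq : ∀ i, ∀ x ∈ (P i).dom,
    (∀ j : Fin k, (j : ℕ) ≠ 0 → hostIndex j = i → x ∉ hostGap j) → map (x : S1) = (G i x : S1)

/-- The `i`-th Cantor set of the second example, in the circle. -/
def SecondExample.cantor {k : ℕ} (E : SecondExample k) (i : Fin k) : Set S1 :=
  (fun x : ℝ => (x : S1)) '' (E.P i).cantor

/-! ### The example on the torus -/

/-- `f (x, y) = (f₁ x, f₂ y)`. -/
def torusProductMap (E₁ : FirstExample) {k : ℕ} (E₂ : SecondExample k) : T2 → T2 :=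
  fun p => (E₁.map p.1, E₂.map p.2)

/-- The product of the normalized Lebesgue measures on the Cantor set of the first example and on
the `i`-th Cantor set of the second example. -/
def torusProductMeasure (E₁ : FirstExample) {k : ℕ} (E₂ : SecondExample k) (i : Fin k) : Measure T2 :=
  (normLeb E₁.cantor).prod (normLeb (E₂.cantor i))

end

/-!
Both Cantor sets are parametrized by itineraries: the point with itinerary `a : ℕ → Bool` is
`mid + ∑ ± offset j`, with sign `-` for `false` and `+` for `true`, and on the Cantor set a Bowen
map is the shift, because it maps gaps onto gaps of the shifted word and these accumulate at the
points of the Cantor set. Flipping one digit translates each of two halves of the Cantor set, so the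
normalized Lebesgue measure becomes a measure on itineraries that is invariant under all flips.

A probability measure on `ι → Bool` that is invariant under the flip of each digit is unique, since
the Walsh functions (finite products of signs of digits) of nonempty sets have integral `0` and all
of them span an algebra that separates points. Uniqueness makes it invariant under relabelling of
the digits by an injective `τ : ι → ι`. Distinct Walsh functions are independent, so when `τ` has no
periodic point the strong law of large numbers, applied along `τ` to each of the countably many
Walsh functions, shows that almost every sequence is generic.

On the torus, the pair of itineraries is one sequence indexed by `ℕ ⊕ ℕ`, and the product measure is
again invariant under flips. Almost every point for the product measure is therefore generic, and
since this measure is absolutely continuous, its basin has positive Lebesgue measure.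
-/

noncomputable section

/-! ### Physical measures and semiconjugacies -/

section Physical

variable {M N : Type*} [MeasurableSpace M] [MeasurableSpace N]

lemma measurePreserving_map_of_semiconj {f : M → M} {g : N → N} {q : M → N} {ν : Measure M}
    (hq : Measurable q) (hg : Measurable g) (hf : MeasurePreserving f ν ν)
    (hqfg : Function.Semiconj q f g) : MeasurePreserving g (ν.map q) (ν.map q) where
  measurable := hg
  map_eq := by
    rw [Measure.map_map hg hq, ← hqfg.comp_eq, ← Measure.map_map hq hf.measurable, hf.map_eq]

variable [TopologicalSpace M] [TopologicalSpace N]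

instance isProbabilityMeasure_empiricMeasure (f : M → M) (n : ℕ) (x : M) :
    IsProbabilityMeasure (empiricMeasure f (n + 1) x) where
  measure_univ := by
    simp only [empiricMeasure, Measure.smul_apply, Measure.finsetSum_apply, measure_univ,
      Finset.sum_const, Finset.card_range, nsmul_eq_mul, mul_one, smul_eq_mul]
    exact ENNReal.inv_mul_cancel (by simp) (by simp)

variable [BorelSpace M] [BorelSpace N]

lemma integral_empiricMeasure (f : M → M) (n : ℕ) (x : M) (φ : C(M, ℝ)) :
    ∫ y, φ y ∂empiricMeasure f n x = (∑ j ∈ Finset.range n, φ (f^[j] x)) / n := by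
  have hφ : StronglyMeasurable φ := φ.continuous.measurable.stronglyMeasurable
  rw [empiricMeasure, integral_smul_measure, integral_finsetSum_measure fun j _ =>
    integrable_dirac' hφ (by simp)]
  simp only [integral_dirac' _ _ hφ, ENNReal.toReal_inv, ENNReal.toReal_natCast, smul_eq_mul]
  rw [div_eq_inv_mul]

lemma mem_statBasin_iff {f : M → M} {ν : Measure M} {x : M} :
    x ∈ statBasin f ν ↔ ∀ φ : C(M, ℝ),
      Tendsto (fun n : ℕ => (∑ j ∈ Finset.range n, φ (f^[j] x)) / n) atTop (𝓝 (∫ y, φ y ∂ν)) := by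
  simp only [statBasin, integral_empiricMeasure, mem_ofPred_eq]

lemma mem_statBasin_map_of_semiconj {f : M → M} {g : N → N} {q : M → N} {ν : Measure M} {x : M}
    (hq : Continuous q) (hqfg : Function.Semiconj q f g) (hx : x ∈ statBasin f ν) :
    q x ∈ statBasin g (ν.map q) := by
  rw [mem_statBasin_iff] at hx ⊢
  intro φ
  rw [integral_map hq.measurable.aemeasurable φ.continuous.aestronglyMeasurable]
  simp only [← (hqfg.iterate_right _).eq]
  exact hx (φ.comp ⟨q, hq⟩)

theorem isPhysical_map_of_semiconj {f : M → M} {g : N → N} {q : M → N} {ν : Measure M}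
    {m : Measure N} [IsProbabilityMeasure ν] (hq : Continuous q) (hg : Measurable g)
    (hqfg : Function.Semiconj q f g) (hf : MeasurePreserving f ν ν)
    (hbasin : ∀ᵐ x ∂ν, x ∈ statBasin f ν) (hac : ν.map q ≪ m) : IsPhysical m g (ν.map q) where
  isProbabilityMeasure := Measure.isProbabilityMeasure_map hq.measurable.aemeasurable
  invariant := measurePreserving_map_of_semiconj hq.measurable hg hf hqfg
  basin_pos := by
    refine pos_iff_ne_zero.2 fun hnull => ?_
    have hν : ∀ᵐ x ∂ν, q x ∉ statBasin g (ν.map q) :=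
      ae_of_ae_map hq.measurable.aemeasurable (measure_eq_zero_iff_ae_notMem.1 (hac hnull))
    obtain ⟨x, hx, hx'⟩ := (hbasin.and hν).exists
    exact hx' (mem_statBasin_map_of_semiconj hq hqfg hx)

end Physical

/-! ### Walsh functions -/

/-- The sign of a binary digit: `-1` for `false` (left), `1` for `true` (right). -/
def boolSign (b : Bool) : ℝ := if b then 1 else -1

@[simp] lemma boolSign_true : boolSign true = 1 := rfl

@[simp] lemma boolSign_false : boolSign false = -1 := rfl

lemma boolSign_not (b : Bool) : boolSign (!b) = -boolSign b := by cases b <;> simp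

lemma boolSign_mul_self (b : Bool) : boolSign b * boolSign b = 1 := by cases b <;> simp

lemma abs_boolSign (b : Bool) : |boolSign b| = 1 := by cases b <;> simp

lemma boolSign_injective : Function.Injective boolSign := by
  intro a b h
  cases a <;> cases b <;> first | rfl | norm_num at h

lemma continuous_boolSign_apply {ι : Type*} (s : ι) :
    Continuous fun a : ι → Bool => boolSign (a s) :=
  (continuous_of_discreteTopology (f := boolSign)).comp (continuous_apply s)

section Walsh

open scoped BoundedContinuousFunction Pointwise

variable {ι : Type*}

/-- The Walsh function of a finite set `S` of indices: the product of the signs of the digits in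
`S`.  It is bundled as a bounded continuous function because weak convergence of probability
measures is tested on these. -/
def walsh (S : Finset ι) : (ι → Bool) →ᵇ ℝ :=
  BoundedContinuousFunction.mkOfCompact
    ⟨fun a => ∏ s ∈ S, boolSign (a s),
      continuous_finsetProd _ fun s _ => continuous_boolSign_apply s⟩

lemma walsh_apply (S : Finset ι) (a : ι → Bool) : walsh S a = ∏ s ∈ S, boolSign (a s) := rfl

lemma walsh_empty : walsh (∅ : Finset ι) = 1 := by ext; simp [walsh_apply]

lemma walsh_singleton_apply (s : ι) (a : ι → Bool) : walsh {s} a = boolSign (a s) := by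
  simp [walsh_apply]

lemma walsh_mul_self (S : Finset ι) : walsh S * walsh S = 1 := by
  ext a
  simp [walsh_apply, ← Finset.prod_mul_distrib, boolSign_mul_self]

lemma walsh_mul [DecidableEq ι] (S T : Finset ι) :
    walsh S * walsh T = walsh (symmDiff S T) := by
  have hS : walsh S = walsh (S ∩ T) * walsh (S \ T) :=
    BoundedContinuousFunction.ext fun a => (Finset.prod_inter_mul_prod_sdiff S T _).symm
  have hT : walsh T = walsh (S ∩ T) * walsh (T \ S) :=
    BoundedContinuousFunction.ext fun a => by
      rw [Finset.inter_comm]; exact (Finset.prod_inter_mul_prod_sdiff T S _).symm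
  have hST : walsh (symmDiff S T) = walsh (S \ T) * walsh (T \ S) :=
    BoundedContinuousFunction.ext fun a => Finset.prod_union disjoint_sdiff_sdiff
  rw [hST, hS, hT]
  linear_combination (walsh (S \ T) * walsh (T \ S)) * walsh_mul_self (S ∩ T)

/-- The linear span of the Walsh functions, as a star subalgebra of the bounded continuous
functions. -/
def walshAlgebra (ι : Type*) : StarSubalgebra ℝ ((ι → Bool) →ᵇ ℝ) where
  toSubalgebra := (Submodule.span ℝ (range walsh)).toSubalgebra
    (Submodule.subset_span ⟨∅, walsh_empty⟩) <| by
      classical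
      intro φ ψ hφ hψ
      have hmul : φ * ψ ∈ Submodule.span ℝ (range walsh * range walsh) :=
        Submodule.span_mul_span ℝ (range walsh) (range walsh) ▸ Submodule.mul_mem_mul hφ hψ
      refine Submodule.span_mono (Set.mul_subset_iff.2 ?_) hmul
      rintro _ ⟨S, rfl⟩ _ ⟨T, rfl⟩
      exact ⟨symmDiff S T, (walsh_mul S T).symm⟩
  star_mem' hφ := hφ

lemma separatesPoints_walshAlgebra :
    ((walshAlgebra ι).map (BoundedContinuousFunction.toContinuousMapStarₐ ℝ)).SeparatesPoints := by
  intro a b hab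
  obtain ⟨s, hs⟩ := Function.ne_iff.1 hab
  refine ⟨walsh {s}, ⟨_, ⟨walsh {s}, Submodule.subset_span (mem_range_self _), rfl⟩, rfl⟩, ?_⟩
  simpa only [walsh_singleton_apply, boolSign_injective.ne_iff] using hs

variable [Countable ι]

lemma measurable_walsh (S : Finset ι) : Measurable (walsh S) := (walsh S).continuous.measurable

theorem tendsto_of_tendsto_integral_walsh {κ : Type*} {l : Filter κ}
    {μ : κ → ProbabilityMeasure (ι → Bool)} {ν : ProbabilityMeasure (ι → Bool)}
    (h : ∀ S, Tendsto (fun k => ∫ a, walsh S a ∂(μ k : Measure (ι → Bool))) l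
      (𝓝 (∫ a, walsh S a ∂(ν : Measure (ι → Bool))))) :
    Tendsto μ l (𝓝 ν) := by
  have : PolishSpace (ι → Bool) :=
    let := TopologicalSpace.metrizableSpaceMetric (ι → Bool)
    inferInstance
  refine ProbabilityMeasure.tendsto_of_tight_of_separatesPoints ℝ .of_compactSpace
    separatesPoints_walshAlgebra fun φ hφ => ?_
  induction (hφ : φ ∈ Submodule.span ℝ (range walsh)) using Submodule.span_induction with
  | mem φ hφ =>
    obtain ⟨S, rfl⟩ := hφ
    exact h S
  | zero => simpa using tendsto_const_nhds
  | add φ ψ _ _ ihφ ihψ =>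
    simp only [BoundedContinuousFunction.add_apply,
      integral_add (φ.integrable _) (ψ.integrable _)]
    exact ihφ.add ihψ
  | smul c φ _ ih =>
    simp only [BoundedContinuousFunction.smul_apply, integral_smul]
    exact ih.const_smul c

lemma mem_statBasin_of_tendsto_walsh {f : (ι → Bool) → ι → Bool} {ν : Measure (ι → Bool)}
    [IsProbabilityMeasure ν] {a : ι → Bool}
    (h : ∀ S, Tendsto (fun n : ℕ => (∑ j ∈ Finset.range n, walsh S (f^[j] a)) / n) atTop
      (𝓝 (∫ a, walsh S a ∂ν))) : a ∈ statBasin f ν := by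
  let μ : ℕ → ProbabilityMeasure (ι → Bool) := fun n => ⟨empiricMeasure f (n + 1) a, inferInstance⟩
  have hconv : Tendsto μ atTop (𝓝 ⟨ν, inferInstance⟩) := by
    refine tendsto_of_tendsto_integral_walsh fun S => ?_
    refine Tendsto.congr (fun n => ?_) ((tendsto_add_atTop_iff_nat 1).2 (h S))
    exact (integral_empiricMeasure f (n + 1) a (walsh S).toContinuousMap).symm
  refine fun φ => (tendsto_add_atTop_iff_nat 1).1 ?_
  exact ProbabilityMeasure.tendsto_iff_forall_integral_tendsto.1 hconv
    (BoundedContinuousFunction.mkOfCompact φ)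

end Walsh

/-! ### Flips of a digit -/

section Flip

variable {ι : Type*} [DecidableEq ι]

/-- The sequence of digits `a` with its `s`-th digit flipped. -/
def flipAt (s : ι) (a : ι → Bool) : ι → Bool := Function.update a s (!a s)

lemma flipAt_self (s : ι) (a : ι → Bool) : flipAt s a s = !a s := Function.update_self ..

lemma flipAt_of_ne {s j : ι} (h : j ≠ s) (a : ι → Bool) : flipAt s a j = a j :=
  Function.update_of_ne h ..

lemma flipAt_involutive (s : ι) : Function.Involutive (flipAt s) := fun a => by
  simp [flipAt]

lemma measurable_flipAt (s : ι) : Measurable (flipAt s) :=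
  measurable_update'.comp
    (measurable_id.prodMk ((measurable_of_finite not).comp (measurable_pi_apply s)))

lemma flipAt_comp {κ : Type*} [DecidableEq κ] {τ : κ → ι} (hτ : Function.Injective τ) (s : κ)
    (a : ι → Bool) : flipAt (τ s) a ∘ τ = flipAt s (a ∘ τ) :=
  Function.update_comp_eq_of_injective a hτ s _

lemma flipAt_inl_elim {κ : Type*} [DecidableEq κ] (s : ι) (a : ι → Bool) (b : κ → Bool) :
    flipAt (Sum.inl s) (Sum.elim a b) = Sum.elim (flipAt s a) b :=
  (Sum.elim_update_left ..).symm

lemma flipAt_inr_elim {κ : Type*} [DecidableEq κ] (s : κ) (a : ι → Bool) (b : κ → Bool) :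
    flipAt (Sum.inr s) (Sum.elim a b) = Sum.elim a (flipAt s b) :=
  (Sum.elim_update_right ..).symm

lemma walsh_flipAt_of_mem {S : Finset ι} {s : ι} (hs : s ∈ S) (a : ι → Bool) :
    walsh S (flipAt s a) = -walsh S a := by
  simp only [walsh_apply, ← Finset.mul_prod_erase S _ hs, flipAt_self, boolSign_not, neg_mul]
  congr 2
  exact Finset.prod_congr rfl fun j hj => by rw [flipAt_of_ne (Finset.ne_of_mem_erase hj)]

lemma walsh_flipAt_of_notMem {S : Finset ι} {s : ι} (hs : s ∉ S) (a : ι → Bool) :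
    walsh S (flipAt s a) = walsh S a :=
  Finset.prod_congr rfl fun j hj => by rw [flipAt_of_ne (ne_of_mem_of_not_mem hj hs)]

/-- Invariance of a measure on binary sequences under the flip of each digit.  Among probability
measures this characterizes the fair coin tossing measure. -/
def IsFlipInvariant (ν : Measure (ι → Bool)) : Prop :=
  ∀ s, MeasurePreserving (flipAt s) ν ν

end Flip

section IndepFun

open ProbabilityTheory

variable {Ω E : Type*} [MeasurableSpace Ω] [MeasurableSpace E] {μ : Measure Ω}
  [IsProbabilityMeasure μ]

/-- `T` exchanges the two halves `X = 1` and `X = -1` of every event `Y ∈ B`. -/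
theorem indepFun_of_measurePreserving_neg {X : Ω → ℝ} {Y : Ω → E} {T : Ω → Ω}
    (hT : MeasurePreserving T μ μ) (hX : Measurable X) (hY : Measurable Y)
    (hXX : ∀ ω, X ω * X ω = 1) (hXT : ∀ ω, X (T ω) = -X ω) (hYT : ∀ ω, Y (T ω) = Y ω) :
    IndepFun X Y μ := by
  rw [indepFun_iff_measure_inter_preimage_eq_mul]
  intro A B hA hB
  let c : ENNReal := A.indicator 1 1 + A.indicator 1 (-1)
  have hc : ∀ ω, A.indicator 1 (X ω) + A.indicator 1 (-X ω) = c := fun ω => by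
    rcases mul_self_eq_one_iff.1 (hXX ω) with h | h
    · rw [h]
    · rw [h, neg_neg, add_comm]
  have hlintegral : ∀ {Z : Ω → ℝ} {B : Set E}, Measurable Z →
      μ (Z ⁻¹' A ∩ Y ⁻¹' B) = ∫⁻ ω in Y ⁻¹' B, A.indicator 1 (Z ω) ∂μ := fun {Z B} hZ => by
    rw [← Measure.restrict_apply (hZ hA), ← lintegral_indicator_one (hZ hA)]; rfl
  have htwo : ∀ {B : Set E}, MeasurableSet B → 2 * μ (X ⁻¹' A ∩ Y ⁻¹' B) = c * μ (Y ⁻¹' B) := by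
    intro B hB
    have hflip : μ (X ⁻¹' A ∩ Y ⁻¹' B) = μ ((-X) ⁻¹' A ∩ Y ⁻¹' B) := by
      rw [← hT.measure_preimage ((hX hA).inter (hY hB)).nullMeasurableSet]
      simp only [preimage_inter, preimage_preimage, hXT, hYT, Pi.neg_def]
    calc 2 * μ (X ⁻¹' A ∩ Y ⁻¹' B)
        = μ (X ⁻¹' A ∩ Y ⁻¹' B) + μ ((-X) ⁻¹' A ∩ Y ⁻¹' B) := by rw [← hflip, two_mul]
      _ = ∫⁻ ω in Y ⁻¹' B, A.indicator 1 (X ω) + A.indicator 1 (-X ω) ∂μ := by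
        rw [hlintegral hX, hlintegral hX.neg, ← lintegral_add_left]
        · rfl
        · exact (measurable_one.indicator hA).comp hX
      _ = c * μ (Y ⁻¹' B) := by simp only [hc, setLIntegral_const]
  have hX2 : 2 * μ (X ⁻¹' A) = c := by simpa using htwo MeasurableSet.univ
  refine (ENNReal.mul_right_inj two_ne_zero ENNReal.ofNat_ne_top).1 ?_
  rw [htwo hB, ← hX2, mul_assoc]

end IndepFun

/-! ### Generic sequences of flip-invariant measures -/

section Generic

variable {ι κ : Type*}

lemma iterate_comp_right {β : Type*} (τ : ι → ι) (j : ℕ) (a : ι → β) :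
    (fun a : ι → β => a ∘ τ)^[j] a = a ∘ τ^[j] := by
  induction j with
  | zero => rfl
  | succ j ih => rw [Function.iterate_succ_apply', ih, Function.iterate_succ]; rfl

lemma measurable_comp_right {β : Type*} [MeasurableSpace β] (τ : κ → ι) :
    Measurable fun a : ι → β => a ∘ τ :=
  measurable_pi_lambda _ fun s => measurable_pi_apply (τ s)

lemma measurable_sumElim_prod {β : Type*} [MeasurableSpace β] :
    Measurable fun p : (ι → β) × (κ → β) => Sum.elim p.1 p.2 :=
  measurable_pi_iff.2 fun s => s.casesOn
    (fun i => (measurable_pi_apply i).comp measurable_fst)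
    fun i => (measurable_pi_apply i).comp measurable_snd

variable [DecidableEq ι]

lemma walsh_comp {τ : κ → ι} (hτ : Function.Injective τ) (S : Finset κ) (a : ι → Bool) :
    walsh S (a ∘ τ) = walsh (S.image τ) a :=
  (Finset.prod_image (f := fun s => boolSign (a s)) hτ.injOn).symm

lemma image_iterate_ne {τ : ι → ι} (hτ : Function.Injective τ)
    (hper : Function.periodicPts τ = ∅) {S : Finset ι} (hS : S.Nonempty) :
    Pairwise fun j k => S.image τ^[j] ≠ S.image τ^[k] := by
  suffices h : ∀ j d, S.image τ^[j] ≠ S.image τ^[j + (d + 1)] by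
    intro j k hjk
    rcases hjk.lt_or_gt with hlt | hlt <;> obtain ⟨d, rfl⟩ := Nat.exists_eq_add_of_lt hlt
    exacts [h j d, (h k d).symm]
  intro j d heq
  have hmaps : MapsTo τ^[d + 1] S S := by
    have himage : S = S.image τ^[d + 1] := by
      refine Finset.image_injective (hτ.iterate j) ?_
      rw [Finset.image_image, ← Function.iterate_add, heq]
    intro s hs
    rw [himage]
    exact Finset.mem_coe.2 (Finset.mem_image_of_mem _ hs)
  obtain ⟨s, hs⟩ := hS
  obtain ⟨n, hn, hsn⟩ := (hmaps.restrict_inj.2 (hτ.iterate _).injOn).mem_periodicPts ⟨s, hs⟩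
  have hsn' : (τ^[d + 1])^[n] s = s := by
    rw [Function.IsPeriodicPt, hmaps.iterate_restrict] at hsn
    exact congrArg Subtype.val hsn.eq
  rw [← Function.iterate_mul] at hsn'
  exact (hper ▸ Function.mk_mem_periodicPts (by positivity) hsn' : s ∈ (∅ : Set ι))

lemma periodicPts_sumMap_succ :
    Function.periodicPts (Sum.map Nat.succ Nat.succ) = ∅ := by
  refine eq_empty_of_forall_notMem ?_
  rintro s ⟨n, hn, hs⟩
  have hiter : ∀ n : ℕ, (Sum.map Nat.succ Nat.succ)^[n] s = Sum.map (· + n) (· + n) s := by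
    intro n
    induction n with
    | zero => cases s <;> rfl
    | succ n ih => rw [Function.iterate_succ_apply', ih]; cases s <;> rfl
  have hfixed : Sum.map (· + n) (· + n) s = s := (hiter n).symm.trans hs
  cases s <;> simp at hfixed <;> lia

variable {ν : Measure (ι → Bool)}

lemma IsFlipInvariant.map_comp_right [DecidableEq κ] (hν : IsFlipInvariant ν) {τ : κ → ι}
    (hτ : Function.Injective τ) : IsFlipInvariant (ν.map fun a => a ∘ τ) := fun s =>
  measurePreserving_map_of_semiconj (measurable_comp_right τ) (measurable_flipAt s) (hν (τ s))
    fun a => flipAt_comp hτ s a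

lemma IsFlipInvariant.prod [DecidableEq κ] {ν' : Measure (κ → Bool)} [SFinite ν] [SFinite ν']
    (hν : IsFlipInvariant ν) (hν' : IsFlipInvariant ν') :
    IsFlipInvariant ((ν.prod ν').map fun p => Sum.elim p.1 p.2) := by
  rintro (s | s)
  · exact measurePreserving_map_of_semiconj measurable_sumElim_prod (measurable_flipAt _)
      ((hν s).prod (.id ν')) fun p => (flipAt_inl_elim s p.1 p.2).symm
  · exact measurePreserving_map_of_semiconj measurable_sumElim_prod (measurable_flipAt _)
      ((MeasurePreserving.id ν).prod (hν' s)) fun p => (flipAt_inr_elim s p.1 p.2).symm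

variable [Countable ι]

lemma IsFlipInvariant.integral_walsh (hν : IsFlipInvariant ν) {S : Finset ι} (hS : S.Nonempty) :
    ∫ a, walsh S a ∂ν = 0 := by
  obtain ⟨s, hs⟩ := hS
  have hflip : ∫ a, walsh S (flipAt s a) ∂ν = ∫ a, walsh S a ∂ν := by
    conv_rhs => rw [← (hν s).map_eq]
    exact (integral_map (hν s).aemeasurable (walsh S).continuous.aestronglyMeasurable).symm
  simp only [walsh_flipAt_of_mem hs, integral_neg] at hflip
  linarith

variable [IsProbabilityMeasure ν]

lemma IsFlipInvariant.eq {ν' : Measure (ι → Bool)} [IsProbabilityMeasure ν']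
    (hν : IsFlipInvariant ν) (hν' : IsFlipInvariant ν') : ν = ν' := by
  obtain ⟨μ, rfl⟩ : ∃ μ : ProbabilityMeasure (ι → Bool), μ = ν := ⟨⟨ν, inferInstance⟩, rfl⟩
  obtain ⟨μ', rfl⟩ : ∃ μ : ProbabilityMeasure (ι → Bool), μ = ν' := ⟨⟨ν', inferInstance⟩, rfl⟩
  have hconst : Tendsto (fun _ : ℕ => μ) atTop (𝓝 μ') := by
    refine tendsto_of_tendsto_integral_walsh fun S => tendsto_const_nhds.congr fun _ => ?_
    rcases S.eq_empty_or_nonempty with rfl | hS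
    · simp [walsh_empty]
    · rw [hν.integral_walsh hS, hν'.integral_walsh hS]
  rw [tendsto_nhds_unique tendsto_const_nhds hconst]

theorem IsFlipInvariant.measurePreserving_comp_right (hν : IsFlipInvariant ν) {τ : ι → ι}
    (hτ : Function.Injective τ) : MeasurePreserving (fun a => a ∘ τ) ν ν where
  measurable := measurable_comp_right τ
  map_eq :=
    have := Measure.isProbabilityMeasure_map (μ := ν) (measurable_comp_right τ).aemeasurable
    (hν.map_comp_right hτ).eq hν

open ProbabilityTheory

lemma IsFlipInvariant.indepFun_walsh (hν : IsFlipInvariant ν) {S T : Finset ι} (hST : S ≠ T) :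
    IndepFun (walsh S) (walsh T) ν := by
  have hdiff : ∀ {S T : Finset ι}, ¬ S ⊆ T → IndepFun (walsh S) (walsh T) ν := by
    intro S T h
    obtain ⟨s, hsS, hsT⟩ := Finset.not_subset.1 h
    exact indepFun_of_measurePreserving_neg (hν s) (measurable_walsh S) (measurable_walsh T)
      (DFunLike.congr_fun (walsh_mul_self S)) (walsh_flipAt_of_mem hsS)
      (walsh_flipAt_of_notMem hsT)
  by_cases h : S ⊆ T
  · exact (hdiff fun h' => hST (h.antisymm h')).symm
  · exact hdiff h

theorem IsFlipInvariant.ae_mem_statBasin (hν : IsFlipInvariant ν) {τ : ι → ι}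
    (hτ : Function.Injective τ) (hper : Function.periodicPts τ = ∅) :
    ∀ᵐ a ∂ν, a ∈ statBasin (fun a => a ∘ τ) ν := by
  have hSLLN : ∀ S : Finset ι, ∀ᵐ a ∂ν, Tendsto (fun n : ℕ =>
      (∑ j ∈ Finset.range n, walsh S ((fun a => a ∘ τ)^[j] a)) / n) atTop
        (𝓝 (∫ a, walsh S a ∂ν)) := fun S => by
    have hiter (j : ℕ) : MeasurePreserving (fun a => a ∘ τ)^[j] ν ν :=
      (hν.measurePreserving_comp_right hτ).iterate j
    refine strong_law_ae_real (fun j a => walsh S ((fun a => a ∘ τ)^[j] a))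
      ((walsh S).integrable ν) (fun j k hjk => ?_) fun j => ?_
    · rcases S.eq_empty_or_nonempty with rfl | hS
      · simpa [Function.onFun, walsh_empty] using indepFun_const_left 1 _
      · simp only [Function.onFun, iterate_comp_right, walsh_comp (hτ.iterate _)]
        exact hν.indepFun_walsh (image_iterate_ne hτ hper hS hjk)
    · have hwalsh := measurable_walsh S
      exact ⟨(hwalsh.comp (hiter j).measurable).aemeasurable, hwalsh.aemeasurable, by
        change ν.map (walsh S ∘ (fun a => a ∘ τ)^[j]) = _
        rw [← Measure.map_map hwalsh (hiter j).measurable, (hiter j).map_eq]; rfl⟩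
  exact (ae_all_iff.2 hSLLN).mono fun a => mem_statBasin_of_tendsto_walsh

end Generic

/-! ### The geometry of Bowen's Cantor sets -/

namespace BowenParam

variable (P : BowenParam)

section Atoms

lemma gapRad_pos (n : ℕ) : 0 < P.gapRad n := by
  cases n with
  | zero => exact P.b_pos
  | succ n => exact half_pos (div_pos (P.α_pos (n + 1) n.succ_pos) (by positivity))

lemma two_mul_atomRad_succ (n : ℕ) : 2 * P.atomRad (n + 1) = P.atomRad n - P.gapRad n := by
  simp only [atomRad]; ring

lemma two_pow_mul_atomRad (n : ℕ) :
    2 ^ (n + 1) * P.atomRad (n + 1) = P.rad - P.b - (∑ j ∈ Finset.range n, P.α (j + 1)) / 2 := by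
  induction n with
  | zero => simp [atomRad, gapRad]; ring
  | succ n ih =>
    have hgap : 2 ^ (n + 1) * P.gapRad (n + 1) = P.α (n + 1) / 2 := by
      simp only [gapRad]; field_simp
    rw [Finset.sum_range_succ, pow_succ, mul_assoc, P.two_mul_atomRad_succ, mul_sub, ih, hgap]
    ring

lemma atomRad_pos (n : ℕ) : 0 < P.atomRad n := by
  cases n with
  | zero => exact P.b_pos.trans P.b_lt_rad
  | succ n =>
    have hsum : ∑ j ∈ Finset.range n, P.α (j + 1) < 2 * (P.rad - P.b) :=
      (P.α_summable.sum_le_tsum _ fun j _ => (P.α_pos (j + 1) j.succ_pos).le).trans_lt P.α_tsum_lt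
    have hpos : 0 < 2 ^ (n + 1) * P.atomRad (n + 1) := by
      rw [two_pow_mul_atomRad]; linarith
    exact pos_of_mul_pos_right hpos (by positivity)

lemma gapRad_lt_atomRad (n : ℕ) : P.gapRad n < P.atomRad n := by
  linarith [P.two_mul_atomRad_succ n, P.atomRad_pos (n + 1)]

lemma atomRad_le (n : ℕ) : P.atomRad n ≤ P.rad * (1 / 2) ^ n := by
  induction n with
  | zero => simp [atomRad]
  | succ n ih =>
    rw [pow_succ]
    linarith [P.two_mul_atomRad_succ n, P.gapRad_pos n]

lemma tendsto_atomRad : Tendsto P.atomRad atTop (𝓝 0) := by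
  refine squeeze_zero (fun n => (P.atomRad_pos n).le) P.atomRad_le ?_
  simpa using (tendsto_pow_atTop_nhds_zero_of_lt_one (r := (1 / 2 : ℝ))
    (by norm_num) (by norm_num)).const_mul P.rad

/-- The distance between the centre of an atom of generation `n` and the centres of the two atoms
of generation `n + 1` that it contains. -/
def offset (n : ℕ) : ℝ := P.gapRad n + P.atomRad (n + 1)

lemma offset_eq_sub (n : ℕ) : P.offset n = P.atomRad n - P.atomRad (n + 1) := by
  rw [offset]; linarith [P.two_mul_atomRad_succ n]

lemma offset_pos (n : ℕ) : 0 < P.offset n := add_pos (P.gapRad_pos n) (P.atomRad_pos (n + 1))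

lemma hasSum_offset : HasSum P.offset P.rad := by
  rw [hasSum_iff_tendsto_nat_of_nonneg fun n => (P.offset_pos n).le]
  simp only [offset_eq_sub, Finset.sum_range_sub']
  simpa [atomRad] using P.tendsto_atomRad.const_sub (P.atomRad 0)

lemma centre_succ (n : ℕ) (a : ℕ → Bool) :
    P.centre (n + 1) a = P.centre n a + boolSign (a n) * P.offset n := by
  cases h : a n <;> simp [centre, h, offset, sub_eq_add_neg, add_comm]

lemma centre_eq_sum (n : ℕ) (a : ℕ → Bool) :
    P.centre n a = P.mid + ∑ j ∈ Finset.range n, boolSign (a j) * P.offset j := by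
  induction n with
  | zero => simp [centre]
  | succ n ih => rw [centre_succ, ih, Finset.sum_range_succ, add_assoc]

lemma centre_congr {n : ℕ} {a b : ℕ → Bool} (h : ∀ j < n, a j = b j) :
    P.centre n a = P.centre n b := by
  rw [centre_eq_sum, centre_eq_sum,
    Finset.sum_congr rfl fun j hj => by rw [h j (Finset.mem_range.1 hj)]]

lemma atom_congr {n : ℕ} {a b : ℕ → Bool} (h : ∀ j < n, a j = b j) : P.atom n a = P.atom n b := by
  rw [atom, atom, P.centre_congr h]

lemma gap_congr {n : ℕ} {a b : ℕ → Bool} (h : ∀ j < n, a j = b j) : P.gap n a = P.gap n b := by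
  rw [gap, gap, P.centre_congr h]

lemma antitone_atom (a : ℕ → Bool) : Antitone fun n => P.atom n a := by
  refine antitone_nat_of_succ_le fun n => ?_
  have hcentre := P.centre_succ n a
  have hrad := P.offset_eq_sub n
  have hpos := P.offset_pos n
  apply Icc_subset_Icc <;> cases h : a n <;>
    simp only [h, boolSign_true, boolSign_false] at hcentre <;> linarith

lemma atom_subset_interval (n : ℕ) (a : ℕ → Bool) : P.atom n a ⊆ P.interval :=
  P.antitone_atom a n.zero_le

lemma gap_subset_atom (n : ℕ) (a : ℕ → Bool) : P.gap n a ⊆ P.atom n a := fun x hx => by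
  have hrad := P.gapRad_lt_atomRad n
  exact ⟨by linarith [hx.1], by linarith [hx.2]⟩

lemma centre_mem_gap (n : ℕ) (a : ℕ → Bool) : P.centre n a ∈ P.gap n a := by
  have hrad := P.gapRad_pos n
  exact ⟨by linarith, by linarith⟩

lemma centre_mem_atom {m n : ℕ} (h : m ≤ n) (a : ℕ → Bool) : P.centre n a ∈ P.atom m a :=
  P.antitone_atom a h (P.gap_subset_atom n a (P.centre_mem_gap n a))

lemma right_of_gap_of_mem_atom {j m : ℕ} {a : ℕ → Bool} {x : ℝ} (hx : x ∈ P.atom m a)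
    (hj : j < m) (ha : a j = true) : P.centre j a + P.gapRad j ≤ x := by
  have h := (P.antitone_atom a hj hx).1
  simp only [centre_succ, ha, boolSign_true, offset] at h
  linarith

lemma left_of_gap_of_mem_atom {j m : ℕ} {a : ℕ → Bool} {x : ℝ} (hx : x ∈ P.atom m a)
    (hj : j < m) (ha : a j = false) : x ≤ P.centre j a - P.gapRad j := by
  have h := (P.antitone_atom a hj hx).2
  simp only [centre_succ, ha, boolSign_false, offset] at h
  linarith

lemma eq_of_mem_atom {j m n : ℕ} {a b : ℕ → Bool} {x : ℝ} (hxa : x ∈ P.atom m a)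
    (hxb : x ∈ P.atom n b) (hm : j < m) (hn : j < n) : a j = b j := by
  induction j using Nat.strong_induction_on with
  | _ j ih =>
    have hcentre : P.centre j a = P.centre j b :=
      P.centre_congr fun i hi => ih i hi (hi.trans hm) (hi.trans hn)
    have hgap := P.gapRad_pos j
    cases ha : a j <;> cases hb : b j <;> try rfl
    · linarith [P.left_of_gap_of_mem_atom hxa hm ha, P.right_of_gap_of_mem_atom hxb hn hb]
    · linarith [P.right_of_gap_of_mem_atom hxa hm ha, P.left_of_gap_of_mem_atom hxb hn hb]

lemma atom_subset_gap_union (n : ℕ) (a : ℕ → Bool) :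
    P.atom n a ⊆ P.gap n a ∪ ⋃ b, P.atom (n + 1) b := by
  have hcentre (s : Bool) : P.centre (n + 1) (Function.update a n s) =
      P.centre n a + boolSign s * P.offset n := by
    rw [centre_succ, Function.update_self,
      P.centre_congr fun j hj => Function.update_of_ne hj.ne s a]
  have hsub := P.offset_eq_sub n
  have hadd : P.offset n = P.gapRad n + P.atomRad (n + 1) := rfl
  intro x hx
  rcases le_or_gt x (P.centre n a - P.gapRad n) with hleft | hleft
  · refine Or.inr (mem_iUnion.2 ⟨Function.update a n false, ?_⟩)
    rw [atom, hcentre, boolSign_false]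
    exact ⟨by linarith [hx.1], by linarith⟩
  rcases lt_or_ge x (P.centre n a + P.gapRad n) with hright | hright
  · exact Or.inl ⟨hleft, hright⟩
  · refine Or.inr (mem_iUnion.2 ⟨Function.update a n true, ?_⟩)
    rw [atom, hcentre, boolSign_true]
    exact ⟨by linarith, by linarith [hx.2]⟩

end Atoms

section Point

/-- The point of the Cantor set that lies in the atoms `I_{a₀ … a_{n-1}}` for all `n`. -/
def point (a : ℕ → Bool) : ℝ := P.mid + ∑' j, boolSign (a j) * P.offset j

lemma norm_boolSign_mul_offset (b : Bool) (n : ℕ) : ‖boolSign b * P.offset n‖ = P.offset n := by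
  rw [norm_mul, Real.norm_eq_abs, abs_boolSign, one_mul, Real.norm_of_nonneg (P.offset_pos n).le]

lemma summable_boolSign_mul_offset (a : ℕ → Bool) :
    Summable fun j => boolSign (a j) * P.offset j :=
  .of_norm_bounded P.hasSum_offset.summable fun j => (P.norm_boolSign_mul_offset (a j) j).le

lemma continuous_point : Continuous P.point :=
  continuous_const.add <| continuous_tsum
    (fun j => (continuous_boolSign_apply j).mul continuous_const) P.hasSum_offset.summable
    fun j a => (P.norm_boolSign_mul_offset (a j) j).le

lemma tendsto_centre (a : ℕ → Bool) : Tendsto (fun n => P.centre n a) atTop (𝓝 (P.point a)) := by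
  simp only [centre_eq_sum]
  exact (P.summable_boolSign_mul_offset a).hasSum.tendsto_sum_nat.const_add _

lemma point_const_true : P.point (fun _ => true) = P.mid + P.rad := by
  simp [point, P.hasSum_offset.tsum_eq]

lemma point_const_false : P.point (fun _ => false) = P.mid - P.rad := by
  simp [point, tsum_neg, P.hasSum_offset.tsum_eq, sub_eq_add_neg]

lemma point_mem_atom (n : ℕ) (a : ℕ → Bool) : P.point a ∈ P.atom n a :=
  isClosed_Icc.mem_of_tendsto (P.tendsto_centre a)
    ((eventually_ge_atTop n).mono fun _ hm => P.centre_mem_atom hm a)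

lemma point_notMem_gap (n : ℕ) (a b : ℕ → Bool) : P.point a ∉ P.gap n b := by
  intro h
  have hgap : P.gap n a = P.gap n b := P.gap_congr fun j hj =>
    P.eq_of_mem_atom (P.point_mem_atom n a) (P.gap_subset_atom n b h) hj hj
  rw [← hgap] at h
  have hmem := P.point_mem_atom (n + 1) a
  cases ha : a n
  · exact (P.left_of_gap_of_mem_atom hmem n.lt_succ_self ha).not_gt h.1
  · exact (P.right_of_gap_of_mem_atom hmem n.lt_succ_self ha).not_gt h.2

lemma point_injective : Function.Injective P.point := fun a b h => funext fun j =>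
  P.eq_of_mem_atom (P.point_mem_atom (j + 1) a) (h ▸ P.point_mem_atom (j + 1) b)
    j.lt_succ_self j.lt_succ_self

lemma measurableEmbedding_point : MeasurableEmbedding P.point :=
  (P.continuous_point.isClosedEmbedding P.point_injective).measurableEmbedding

lemma tendsto_of_mem_atom {x : ℕ → ℝ} {a : ℕ → Bool} (h : ∀ n, x n ∈ P.atom n a) :
    Tendsto x atTop (𝓝 (P.point a)) := by
  refine (P.tendsto_centre a).congr_dist (squeeze_zero (fun _ => dist_nonneg) (fun n => ?_)
    P.tendsto_atomRad)
  rw [dist_comm, ← Metric.mem_closedBall, Real.closedBall_eq_Icc]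
  exact h n

lemma cantor_eq_range : P.cantor = range P.point := by
  refine Subset.antisymm (fun x hx => ?_) ?_
  · have hword : ∀ n, ∃ a, x ∈ P.atom n a := by simpa [cantor] using hx
    choose w hw using hword
    refine ⟨fun j => w (j + 1) j, tendsto_nhds_unique (P.tendsto_of_mem_atom fun n => ?_)
      tendsto_const_nhds⟩
    rw [P.atom_congr fun j hj => P.eq_of_mem_atom (hw (j + 1)) (hw n) j.lt_succ_self hj]
    exact hw n
  · rintro _ ⟨a, rfl⟩
    exact mem_iInter.2 fun n => mem_iUnion.2 ⟨a, P.point_mem_atom n a⟩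

lemma cantor_subset_interval : P.cantor ⊆ P.interval := by
  rw [cantor_eq_range]
  rintro _ ⟨a, rfl⟩
  exact P.point_mem_atom 0 a

lemma isCompact_cantor : IsCompact P.cantor :=
  P.cantor_eq_range ▸ isCompact_range P.continuous_point

lemma atom_one_subset_dom (a : ℕ → Bool) : P.atom 1 a ⊆ P.dom := fun x hx => by
  have hI : x ∈ P.interval := P.atom_subset_interval 1 a hx
  cases ha : a 0
  · exact Or.inl ⟨hI.1, P.left_of_gap_of_mem_atom hx one_pos ha⟩
  · exact Or.inr ⟨P.right_of_gap_of_mem_atom hx one_pos ha, hI.2⟩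

lemma point_mem_dom (a : ℕ → Bool) : P.point a ∈ P.dom :=
  P.atom_one_subset_dom a (P.point_mem_atom 1 a)

end Point

section Volume

lemma interval_subset_cantor_union_gaps : P.interval ⊆ P.cantor ∪ ⋃ n, ⋃ a, P.gap n a := by
  intro x hx
  by_contra hx'
  simp only [mem_union, mem_iUnion, not_or, not_exists] at hx'
  refine hx'.1 (mem_iInter.2 fun n => ?_)
  induction n with
  | zero => exact mem_iUnion.2 ⟨fun _ => false, hx⟩
  | succ n ih =>
    obtain ⟨a, ha⟩ := mem_iUnion.1 ih
    exact (P.atom_subset_gap_union n a ha).resolve_left (hx'.2 n a)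

lemma volume_iUnion_gap_le (n : ℕ) :
    volume (⋃ a, P.gap n a) ≤ ENNReal.ofReal (2 ^ n * (2 * P.gapRad n)) := by
  have hwords : ⋃ a, P.gap n a ⊆
      ⋃ S ∈ (Finset.range n).powerset, P.gap n fun j => decide (j ∈ S) := by
    refine iUnion_subset fun a => ?_
    rw [P.gap_congr (b := fun j => decide (j ∈ (Finset.range n).filter fun j => a j = true))
      fun j hj => by simp [hj]]
    exact subset_biUnion_of_mem (u := fun S : Finset ℕ => P.gap n fun j => decide (j ∈ S))
      (Finset.mem_powerset.2 (Finset.filter_subset ..))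
  calc volume (⋃ a, P.gap n a)
      ≤ ∑ S ∈ (Finset.range n).powerset, volume (P.gap n fun j => decide (j ∈ S)) :=
        (measure_mono hwords).trans (measure_biUnion_finset_le _ _)
    _ = ∑ _S ∈ (Finset.range n).powerset, ENNReal.ofReal (2 * P.gapRad n) :=
        Finset.sum_congr rfl fun S _ => by rw [gap, Real.volume_Ioo]; ring_nf
    _ = ENNReal.ofReal (2 ^ n * (2 * P.gapRad n)) := by
        rw [ENNReal.ofReal_mul (p := 2 ^ n) (by positivity), ENNReal.ofReal_pow zero_le_two]
        simp

lemma hasSum_gap_lengths :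
    HasSum (fun n => 2 ^ n * (2 * P.gapRad n)) (2 * P.b + ∑' n, P.α (n + 1)) := by
  have hα (n : ℕ) : 2 ^ (n + 1) * (2 * P.gapRad (n + 1)) = P.α (n + 1) := by
    simp only [gapRad]; field_simp
  refine (hasSum_nat_add_iff' 1).1 ?_
  simp only [hα]
  simpa [gapRad] using P.α_summable.hasSum

lemma volume_gaps_lt_volume_interval : volume (⋃ n, ⋃ a, P.gap n a) < volume P.interval :=
  calc volume (⋃ n, ⋃ a, P.gap n a)
      ≤ ∑' n, ENNReal.ofReal (2 ^ n * (2 * P.gapRad n)) :=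
        (measure_iUnion_le _).trans (ENNReal.tsum_le_tsum P.volume_iUnion_gap_le)
    _ = ENNReal.ofReal (2 * P.b + ∑' n, P.α (n + 1)) := by
        rw [← P.hasSum_gap_lengths.tsum_eq, ENNReal.ofReal_tsum_of_nonneg (fun n => ?_)
          P.hasSum_gap_lengths.summable]
        have hgap := P.gapRad_pos n
        positivity
    _ < volume P.interval := by
        rw [interval, Real.volume_Icc]
        refine ENNReal.ofReal_lt_ofReal_iff'.2 ⟨?_, ?_⟩ <;>
          linarith [P.α_tsum_lt, P.b_pos, P.b_lt_rad]

theorem volume_cantor_pos : 0 < volume P.cantor := by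
  by_contra! h
  refine P.volume_gaps_lt_volume_interval.not_ge ?_
  calc volume P.interval
      ≤ volume P.cantor + volume (⋃ n, ⋃ a, P.gap n a) :=
        (measure_mono P.interval_subset_cantor_union_gaps).trans (measure_union_le _ _)
    _ = volume (⋃ n, ⋃ a, P.gap n a) := by rw [nonpos_iff_eq_zero.1 h, zero_add]

end Volume

end BowenParam

theorem IsBowenMap.apply_point {P : BowenParam} {G : ℝ → ℝ} (hG : IsBowenMap P G)
    (a : ℕ → Bool) : G (P.point a) = P.point (shiftSeq a) := by
  have hcentre : Tendsto (fun n => P.centre (n + 1) a) atTop (𝓝[P.dom] (P.point a)) :=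
    tendsto_nhdsWithin_iff.2 ⟨(tendsto_add_atTop_iff_nat 1).2 (P.tendsto_centre a),
      .of_forall fun n => P.atom_one_subset_dom a (P.centre_mem_atom (Nat.le_add_left 1 n) a)⟩
  refine tendsto_nhds_unique ((hG.continuousOn _ (P.point_mem_dom a)).tendsto.comp hcentre)
    (P.tendsto_of_mem_atom fun n => P.gap_subset_atom n _ ?_)
  rw [← hG.image_gap n a]
  exact mem_image_of_mem G (P.centre_mem_gap (n + 1) a)

section CodeMeasure

lemma measurePreserving_comap_of_forall_eq_add {α κ V : Type*} [MeasurableSpace α]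
    [MeasurableSpace κ] [MeasurableSingletonClass κ] [Countable κ] [MeasurableSpace V] [AddGroup V]
    [MeasurableAdd V] {μ : Measure V} [μ.IsAddRightInvariant] {q : α → V}
    (hq : MeasurableEmbedding q) (T : α ≃ᵐ α) {c : α → κ} (hc : Measurable c) (d : κ → V)
    (h : ∀ a, q (T a) = q a + d (c a)) : MeasurePreserving T (μ.comap q) (μ.comap q) := by
  -- On each level set of `c` the map `T` acts, seen through `q`, as a translation.
  have hpiece (A : Set α) (k : κ) :
      μ.comap q (T '' (A ∩ c ⁻¹' {k})) = μ.comap q (A ∩ c ⁻¹' {k}) := by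
    have himage : q '' (T '' (A ∩ c ⁻¹' {k})) = (· + d k) '' (q '' (A ∩ c ⁻¹' {k})) := by
      rw [image_image, image_image]
      exact image_congr fun a ha => by rw [h, ha.2]
    rw [hq.comap_apply, hq.comap_apply, himage, image_add_right, measure_preimage_add_right]
  refine MeasurePreserving.symm T.symm ⟨T.symm.measurable, Measure.ext fun A hA => ?_⟩
  have hmeas (k : κ) : MeasurableSet (A ∩ c ⁻¹' {k}) := hA.inter (hc (measurableSet_singleton k))
  have hdisj : Pairwise (Function.onFun Disjoint fun k => A ∩ c ⁻¹' {k}) := fun j k hjk =>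
    ((disjoint_singleton.2 hjk).preimage c).mono inter_subset_right inter_subset_right
  have hunion : ⋃ k, A ∩ c ⁻¹' {k} = A := by
    rw [← inter_iUnion, ← preimage_iUnion, iUnion_of_singleton, preimage_univ, inter_univ]
  calc (μ.comap q).map T.symm A
      = μ.comap q (⋃ k, T '' (A ∩ c ⁻¹' {k})) := by
        rw [T.symm.map_apply, ← T.image_eq_preimage_symm, ← image_iUnion, hunion]
    _ = ∑' k, μ.comap q (A ∩ c ⁻¹' {k}) := by
        rw [measure_iUnion (fun j k hjk => (disjoint_image_iff T.injective).2 (hdisj hjk))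
          fun k => T.measurableSet_image.2 (hmeas k)]
        simp only [hpiece]
    _ = μ.comap q A := by rw [← measure_iUnion hdisj hmeas, hunion]

namespace BowenParam

variable (P : BowenParam)

/-- The normalized Lebesgue measure of the Cantor set, transported to the space of itineraries. -/
def codeMeasure : Measure (ℕ → Bool) := (volume P.cantor)⁻¹ • volume.comap P.point

lemma map_point_codeMeasure :
    P.codeMeasure.map P.point = ProbabilityTheory.cond volume P.cantor := by
  rw [codeMeasure, Measure.map_smul, P.measurableEmbedding_point.map_comap, ← cantor_eq_range]
  rfl

instance isProbabilityMeasure_codeMeasure : IsProbabilityMeasure P.codeMeasure := by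
  have := ProbabilityTheory.cond_isProbabilityMeasure_of_finite P.volume_cantor_pos.ne'
    P.isCompact_cantor.measure_ne_top
  rw [← map_point_codeMeasure] at this
  exact Measure.isProbabilityMeasure_of_map P.point

lemma point_flipAt (s : ℕ) (a : ℕ → Bool) :
    P.point (flipAt s a) = P.point a + -2 * boolSign (a s) * P.offset s := by
  have h := (P.summable_boolSign_mul_offset (flipAt s a)).tsum_sub
    (P.summable_boolSign_mul_offset a)
  rw [tsum_eq_single s fun j hj => by rw [flipAt_of_ne hj, sub_self], flipAt_self,
    boolSign_not] at h
  simp only [point]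
  linarith

theorem isFlipInvariant_codeMeasure : IsFlipInvariant P.codeMeasure := fun s => by
  let T : (ℕ → Bool) ≃ᵐ (ℕ → Bool) :=
    ⟨(flipAt_involutive s).toPerm, measurable_flipAt s, measurable_flipAt s⟩
  exact (measurePreserving_comap_of_forall_eq_add P.measurableEmbedding_point T
    (measurable_pi_apply s) (fun b => -2 * boolSign b * P.offset s)
    (P.point_flipAt s)).smul_measure _

end BowenParam

end CodeMeasure

/-! ### Cantor sets on the circle and on the torus -/

section Circle

variable {p a x y : ℝ}

lemma eq_of_coe_addCircle_eq (hx : x ∈ Ioo a (a + p)) (hy : y ∈ Icc a (a + p))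
    (h : (x : AddCircle p) = y) : x = y := by
  obtain ⟨n, hn⟩ := QuotientAddGroup.eq_iff_sub_mem.1 h.symm
  simp only [zsmul_eq_mul] at hn
  have hp : 0 < p := by linarith [hx.1, hx.2]
  have hlt : (n : ℝ) * p < 1 * p := by linarith [hx.1, hy.2]
  have hgt : (-1 : ℝ) * p < n * p := by linarith [hx.2, hy.1]
  have hn0 : n = 0 := by
    have h1 : (n : ℝ) < 1 := lt_of_mul_lt_mul_right hlt hp.le
    have h2 : (-1 : ℝ) < n := lt_of_mul_lt_mul_right hgt hp.le
    norm_cast at h1 h2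
    lia
  rw [hn0] at hn
  push_cast at hn
  linarith

variable [Fact (0 < p)]

lemma liftIco_coe_apply_of_mem_Icc {B : Type*} {f : ℝ → B} (hf : f a = f (a + p))
    (hx : x ∈ Icc a (a + p)) : AddCircle.liftIco p a f x = f x := by
  rcases hx.2.lt_or_eq with hlt | rfl
  · exact AddCircle.liftIco_coe_apply ⟨hx.1, hlt⟩
  · rw [← AddCircle.liftIoc_eq_liftIco hf, AddCircle.liftIoc_coe_apply]
    exact ⟨lt_add_of_pos_right a Fact.out, le_rfl⟩

lemma restrict_coe_image_eq_map {K : Set ℝ} (hK : IsCompact K) (hKI : K ⊆ Icc a (a + p)) :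
    (volume : Measure (AddCircle p)).restrict ((↑) '' K) =
      (volume.restrict K).map ((↑) : ℝ → AddCircle p) := by
  have hcoe := AddCircle.measurePreserving_mk p a
  have hmeas : MeasurableSet (((↑) : ℝ → AddCircle p) '' K) :=
    (hK.image (AddCircle.continuous_mk' p)).measurableSet
  rw [← hcoe.map_eq, Measure.restrict_map hcoe.measurable hmeas,
    Measure.restrict_restrict (hcoe.measurable hmeas)]
  congr 1
  refine Measure.restrict_congr_set ?_
  filter_upwards [Measure.ae_ne volume a, Measure.ae_ne volume (a + p)] with x hxa hxp
  refine propext ⟨?_, fun hx => ⟨mem_image_of_mem _ hx, ?_⟩⟩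
  · rintro ⟨⟨y, hy, hyx⟩, hx⟩
    exact eq_of_coe_addCircle_eq ⟨hx.1, hx.2.lt_of_ne hxp⟩ (hKI hy) hyx.symm ▸ hy
  · exact ⟨(hKI hx).1.lt_of_ne' hxa, (hKI hx).2⟩

lemma cond_coe_image_eq_map {K : Set ℝ} (hK : IsCompact K) (hKI : K ⊆ Icc a (a + p)) :
    ProbabilityTheory.cond (volume : Measure (AddCircle p)) ((↑) '' K) =
      (ProbabilityTheory.cond volume K).map ((↑) : ℝ → AddCircle p) := by
  have hrestrict := restrict_coe_image_eq_map hK hKI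
  have hcoe : Measurable ((↑) : ℝ → AddCircle p) := (AddCircle.continuous_mk' p).measurable
  have hvolume : (volume : Measure (AddCircle p)) ((↑) '' K) = volume K := by
    rw [← Measure.restrict_apply_univ, hrestrict, Measure.map_apply hcoe .univ, preimage_univ,
      Measure.restrict_apply_univ]
  rw [ProbabilityTheory.cond, ProbabilityTheory.cond, hrestrict, hvolume, Measure.map_smul]

end Circle

lemma IsC1ExpandingCircleMap.continuous {f : S1 → S1} (hf : IsC1ExpandingCircleMap f) :
    Continuous f := by
  obtain ⟨F, hF, -, hfF⟩ := hf
  have hquot : IsQuotientMap ((↑) : ℝ → S1) := QuotientAddGroup.isQuotientMap_mk _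
  exact hquot.continuous_iff.2
    (((AddCircle.continuous_mk' 2).comp hF.continuous).congr fun x => (hfF x).symm)

namespace BowenParam

variable (P : BowenParam)

/-- The image in the circle of the point of the Cantor set with the given itinerary. -/
def circlePoint (a : ℕ → Bool) : S1 := (P.point a : S1)

lemma continuous_circlePoint : Continuous P.circlePoint :=
  (AddCircle.continuous_mk' 2).comp P.continuous_point

lemma normLeb_coe_image_cantor (h : P.interval ⊆ Icc (-1) 1) :
    normLeb ((fun x : ℝ => (x : S1)) '' P.cantor) = P.codeMeasure.map P.circlePoint := by
  have hK : P.cantor ⊆ Icc (-1) (-1 + 2) := by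
    rw [show (-1 + 2 : ℝ) = 1 by norm_num]
    exact P.cantor_subset_interval.trans h
  have hcoe : Measurable ((↑) : ℝ → S1) := (AddCircle.continuous_mk' 2).measurable
  rw [normLeb, cond_coe_image_eq_map P.isCompact_cantor hK, ← map_point_codeMeasure,
    Measure.map_map hcoe P.continuous_point.measurable]
  rfl

end BowenParam

namespace FirstExample

variable (E : FirstExample)

lemma interval_eq_Icc : E.P.interval = Icc (-1) 1 := by
  rw [BowenParam.interval, E.mid_eq, E.rad_eq, zero_sub, zero_add]

lemma intervalMap_point (a : ℕ → Bool) :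
    E.intervalMap (E.P.point a) = E.P.point (shiftSeq a) := by
  have hgap : E.P.gap 0 a = Ioo (-E.P.b) E.P.b := by
    simp [BowenParam.gap, BowenParam.centre, BowenParam.gapRad, E.mid_eq]
  rw [intervalMap, if_neg (hgap ▸ E.P.point_notMem_gap 0 a a), E.isBowenMap.apply_point]

lemma map_circlePoint (a : ℕ → Bool) :
    E.map (E.P.circlePoint a) = E.P.circlePoint (shiftSeq a) := by
  have hleft : E.intervalMap (-1) = -1 := by
    have h : E.intervalMap (E.P.point fun _ => false) = E.P.point fun _ => false :=
      E.intervalMap_point _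
    rwa [E.P.point_const_false, E.mid_eq, E.rad_eq, zero_sub] at h
  have hright : E.intervalMap (-1 + 2) = 1 := by
    have h : E.intervalMap (E.P.point fun _ => true) = E.P.point fun _ => true :=
      E.intervalMap_point _
    rw [E.P.point_const_true, E.mid_eq, E.rad_eq, zero_add] at h
    rwa [show (-1 + 2 : ℝ) = 1 by norm_num]
  have hends : (E.intervalMap (-1) : S1) = (E.intervalMap (-1 + 2) : S1) := by
    rw [hleft, hright, ← AddCircle.coe_add_period 2 (-1 : ℝ)]
    norm_num
  have hmem : E.P.point a ∈ Icc (-1) (-1 + 2) := by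
    have h := E.interval_eq_Icc ▸ E.P.atom_subset_interval 0 a (E.P.point_mem_atom 0 a)
    exact ⟨h.1, by linarith [h.2]⟩
  rw [map, BowenParam.circlePoint, liftIco_coe_apply_of_mem_Icc hends hmem, intervalMap_point]
  rfl

lemma mem_dom_of_notMem_gap {x : ℝ} (hx : x ∈ Icc (-1) 1) (hgap : x ∉ Ioo (-E.P.b) E.P.b) :
    x ∈ E.P.dom := by
  rw [BowenParam.dom, E.mid_eq, E.rad_eq, zero_sub, zero_sub, zero_add, zero_add]
  rcases le_or_gt x (-E.P.b) with h | h
  · exact Or.inl ⟨hx.1, h⟩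
  · exact Or.inr ⟨not_lt.1 fun h' => hgap ⟨h, h'⟩, hx.2⟩

lemma measurable_map : Measurable E.map := by
  classical
  let I : Set ℝ := Ico (-1) (-1 + 2)
  let gap : Set I := (↑) ⁻¹' Ioo (-E.P.b) E.P.b
  have hGc : ContinuousOn (fun x : I => E.Gc x) gap :=
    E.contDiffOn_Gc.continuousOn.comp continuous_subtype_val.continuousOn
      fun x hx => Ioo_subset_Icc_self hx
  have hG : ContinuousOn (fun x : I => E.G x) gapᶜ :=
    E.isBowenMap.continuousOn.comp continuous_subtype_val.continuousOn
      fun x hx => E.mem_dom_of_notMem_gap ⟨x.2.1, by linarith [x.2.2]⟩ hx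
  have hmap : E.map = (↑) ∘ gap.piecewise (fun x => E.Gc x) (fun x => E.G x) ∘
      AddCircle.measurableEquivIco 2 (-1) := by
    have hpiecewise : (fun x : I => E.intervalMap x) =
        gap.piecewise (fun x => E.Gc x) fun x => E.G x := by
      funext x
      by_cases hx : x ∈ gap
      · rw [piecewise_eq_of_mem _ _ _ hx]
        exact if_pos hx
      · rw [piecewise_eq_of_notMem _ _ _ hx]
        exact if_neg hx
    rw [← hpiecewise]
    rfl
  rw [hmap]
  exact (AddCircle.continuous_mk' 2).measurable.comp <|
    (hGc.measurable_piecewise hG (measurable_subtype_coe measurableSet_Ioo)).comp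
      (MeasurableEquiv.measurable _)

end FirstExample

namespace SecondExample

variable {k : ℕ} (E : SecondExample k)

lemma interval_subset_Icc (i : Fin k) : (E.P i).interval ⊆ Icc (-1) 1 := by
  induction i using WellFoundedLT.induction with
  | _ i ih =>
    by_cases hi : (i : ℕ) = 0
    · rw [BowenParam.interval, E.mid_eq i hi, E.rad_eq i hi, zero_sub, zero_add]
    · obtain ⟨n, a, hgap⟩ := E.hostGap_isGap i hi
      calc (E.P i).interval ⊆ E.hostGap i := E.interval_subset i hi
        _ = (E.P (E.hostIndex i)).gap n a := hgap
        _ ⊆ (E.P (E.hostIndex i)).atom n a := BowenParam.gap_subset_atom _ n a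
        _ ⊆ (E.P (E.hostIndex i)).interval := BowenParam.atom_subset_interval _ n a
        _ ⊆ Icc (-1) 1 := ih _ (E.hostIndex_lt i hi)

lemma map_circlePoint (i : Fin k) (a : ℕ → Bool) :
    E.map ((E.P i).circlePoint a) = (E.P i).circlePoint (shiftSeq a) := by
  rw [BowenParam.circlePoint, E.map_eq i _ ((E.P i).point_mem_dom a), (E.isBowenMap i).apply_point]
  · rfl
  · rintro j hj rfl hmem
    obtain ⟨n, b, hgap⟩ := E.hostGap_isGap j hj
    exact BowenParam.point_notMem_gap _ n a b (hgap ▸ hmem)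

end SecondExample

section Torus

variable (E₁ : FirstExample) {k : ℕ} (E₂ : SecondExample k) (i : Fin k)

/-- The point of the product Cantor set in the torus whose two itineraries are the restrictions of
`a` to the two copies of `ℕ`. -/
def torusPoint (a : ℕ ⊕ ℕ → Bool) : T2 :=
  (E₁.P.circlePoint (a ∘ Sum.inl), (E₂.P i).circlePoint (a ∘ Sum.inr))

/-- The product of the two code measures, as a measure on single sequences indexed by `ℕ ⊕ ℕ`. -/
def torusCodeMeasure : Measure (ℕ ⊕ ℕ → Bool) :=
  (E₁.P.codeMeasure.prod (E₂.P i).codeMeasure).map fun p => Sum.elim p.1 p.2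

instance isProbabilityMeasure_torusCodeMeasure :
    IsProbabilityMeasure (torusCodeMeasure E₁ E₂ i) :=
  Measure.isProbabilityMeasure_map measurable_sumElim_prod.aemeasurable

lemma isFlipInvariant_torusCodeMeasure : IsFlipInvariant (torusCodeMeasure E₁ E₂ i) :=
  E₁.P.isFlipInvariant_codeMeasure.prod (E₂.P i).isFlipInvariant_codeMeasure

lemma continuous_torusPoint : Continuous (torusPoint E₁ E₂ i) :=
  (E₁.P.continuous_circlePoint.comp (continuous_pi fun _ => continuous_apply _)).prodMk
    ((E₂.P i).continuous_circlePoint.comp (continuous_pi fun _ => continuous_apply _))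

lemma torusProductMap_torusPoint (a : ℕ ⊕ ℕ → Bool) :
    torusProductMap E₁ E₂ (torusPoint E₁ E₂ i a) =
      torusPoint E₁ E₂ i (a ∘ Sum.map Nat.succ Nat.succ) :=
  Prod.ext (E₁.map_circlePoint (a ∘ Sum.inl)) (E₂.map_circlePoint i (a ∘ Sum.inr))

lemma measurable_torusProductMap : Measurable (torusProductMap E₁ E₂) :=
  E₁.measurable_map.prodMap E₂.expanding.continuous.measurable

lemma map_torusPoint_torusCodeMeasure :
    (torusCodeMeasure E₁ E₂ i).map (torusPoint E₁ E₂ i) = torusProductMeasure E₁ E₂ i := by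
  rw [torusProductMeasure, FirstExample.cantor, SecondExample.cantor,
    E₁.P.normLeb_coe_image_cantor E₁.interval_eq_Icc.subset,
    (E₂.P i).normLeb_coe_image_cantor (E₂.interval_subset_Icc i),
    Measure.map_prod_map _ _ E₁.P.continuous_circlePoint.measurable
      (E₂.P i).continuous_circlePoint.measurable,
    torusCodeMeasure,
    Measure.map_map (continuous_torusPoint E₁ E₂ i).measurable measurable_sumElim_prod]
  rfl

lemma torusProductMeasure_absolutelyContinuous :
    torusProductMeasure E₁ E₂ i ≪ (volume : Measure T2) :=
  ProbabilityTheory.cond_absolutelyContinuous.prod ProbabilityTheory.cond_absolutelyContinuous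

end Torus

end

theorem mainTheorem9 (E₁ : FirstExample) (k : ℕ) (E₂ : SecondExample k) (i : Fin k) :
    IsPhysical (volume : Measure T2) (torusProductMap E₁ E₂) (torusProductMeasure E₁ E₂ i) := by
  have hflip : IsFlipInvariant (torusCodeMeasure E₁ E₂ i) :=
    isFlipInvariant_torusCodeMeasure E₁ E₂ i
  have hshift : Function.Injective (Sum.map Nat.succ Nat.succ) :=
    Nat.succ_injective.sumMap Nat.succ_injective
  have hsemiconj : Function.Semiconj (torusPoint E₁ E₂ i) (fun a => a ∘ Sum.map Nat.succ Nat.succ)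
      (torusProductMap E₁ E₂) := fun a => (torusProductMap_torusPoint E₁ E₂ i a).symm
  rw [← map_torusPoint_torusCodeMeasure]
  refine isPhysical_map_of_semiconj (continuous_torusPoint E₁ E₂ i)
    (measurable_torusProductMap E₁ E₂) hsemiconj (hflip.measurePreserving_comp_right hshift)
    (hflip.ae_mem_statBasin hshift periodicPts_sumMap_succ) ?_
  rw [map_torusPoint_torusCodeMeasure]
  exact torusProductMeasure_absolutelyContinuous E₁ E₂ i
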